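/- A $3$-graph is a finite hypergraph all of whose edges have exactly three vertices. A homomorphism from a $3$-graph $F$ to a $3$-graph $H$ is a map $V(F)\to V(H)$ under which the image of every edge of $F$ is an edge of $H$; let $\hom(F,H)$ be the number of these maps and let $t_F(H)=\hom(F,H)/v(H)^{v(F)}$. Let $K_3^{(3)}$ be the $3$-graph with three vertices and one edge. The Sidorenko exponent of a $3$-partite $3$-graph $F$ is $$s(F)=\sup\{s\ge 0:\ \text{there is a 3-graph } H \text{ with } t_F(H)=t_{K_3^{(3)}}(H)^s>0\}.$$ For $k\ge 3$, let $C_k^{(3)}$ be the $3$-uniform tight cycle of length $k$: its vertices are the residues modulo $k$ and its edges are the sets $\{i,i+1,i+2\}$. **Theorem.** For all integers $\ell\ge 2$, $$s\bigl(C^{(3)}_{3\ell}\bigr)\le 7\ell.$$ -/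

import Mathlib

open scoped ENNReal NNReal

namespace Hypergraph

/-- `H` is an `r`-graph: every edge has exactly `r` vertices. -/
def IsUniform {α : Type*} (H : Hypergraph α) (r : ℕ) : Prop :=
  ∀ e ∈ H.edgeSet, e.encard = r

/-- `Hom(F, H)`: the maps from the vertex set of `F` to the vertex set of `H` under which the image
of every edge of `F` is an edge of `H`. -/
def Hom {α β : Type*} (F : Hypergraph α) (H : Hypergraph β) : Type _ :=
  {φ : F.vertexSet → H.vertexSet //
    ∀ e ∈ F.edgeSet, {y : β | ∃ x : F.vertexSet, (x : α) ∈ e ∧ (φ x : β) = y} ∈ H.edgeSet}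

/-- The homomorphism density `t_F(H) = hom(F, H) / v(H) ^ v(F)`, for hypergraphs with finitely many
vertices. -/
noncomputable def homDensity {α β : Type*} (F : Hypergraph α) (H : Hypergraph β) : ℝ :=
  (Nat.card (Hom F H) : ℝ) / (H.vertexSet.ncard : ℝ) ^ F.vertexSet.ncard

/-- The complete `r`-graph `K_k^{(r)}` on `k` vertices. -/
def completeUniform (k r : ℕ) : Hypergraph (Fin k) where
  vertexSet := Set.univ
  edgeSet := {e | e.encard = r}
  subset_vertexSet_of_mem_edgeSet' := fun _ _ => Set.subset_univ _

/-- The Sidorenko exponent of an `r`-graph `F`: the supremum, taken in `[0, ∞]`, of the real numbers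
`s ≥ 0` for which some finite `r`-graph `H` satisfies `t_F(H) = t_{K_r^{(r)}}(H) ^ s > 0`. -/
noncomputable def sidorenkoExponent {α : Type*} (r : ℕ) (F : Hypergraph α) : ℝ≥0∞ :=
  ⨆ (s : ℝ≥0) (_ : ∃ (V : Type) (H : Hypergraph V), H.vertexSet.Finite ∧ H.IsUniform r ∧
    homDensity F H = homDensity (completeUniform r r) H ^ (s : ℝ) ∧
    0 < homDensity (completeUniform r r) H ^ (s : ℝ)), (s : ℝ≥0∞)

/-- The `r`-uniform tight cycle of length `k` (for `k ≥ r`, `k ≥ 1`): the vertices are the residues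
modulo `k` and the edges are the sets `{i, i + 1, …, i + r - 1}`. -/
def tightCycle (r k : ℕ) : Hypergraph (ZMod k) where
  vertexSet := Set.univ
  edgeSet := {e | ∃ i : ZMod k, e = {x | ∃ j : ℕ, j < r ∧ x = i + (j : ZMod k)}}
  subset_vertexSet_of_mem_edgeSet' := fun _ _ => Set.subset_univ _

end Hypergraph

/-! Let `n` be the number of vertices of `H` and `p = T / n ^ 3` its edge density. The core is
`t_C(H) ≥ p ^ (4ℓ + 2)` when `p > 0`; since `p < 1`, an equality `t_C(H) = p ^ s` then forces `s ≤
4ℓ + 2 ≤ 7ℓ`.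

Closed tight walks of length `3ℓ` are counted by the trace of `tightStep ^ ℓ`. That matrix need not
be symmetric, but demanding one extra edge, which closes a four-cycle in a link, gives a smaller
symmetric matrix `S = squareStep`. For `ℓ = 2m` the trace of `S ^ (2m)` is the sum of the squared
entries of `S ^ m`, so Cauchy–Schwarz leaves only the total of the entries of `S ^ m` to be bounded.

That total is bounded by averaging logarithms over ordered edges. Gibbs' inequality is applied to a
symmetric Markov kernel on the edges of each link, for which the uniform measure is stationary
(`sum_log_linkSquare_ge`). The bound holds for an arbitrary weight `k`, so it can be iterated
without any regularity of `H`; each step of `S` gains `p ^ 4 * n ^ 3`.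

For odd `ℓ`, three middle factors of `tightStep` are bounded below by `B * Bᵀ` with `B = halfBlock`,
built from two nested link four-cycles. This costs the extra `p ^ 2`. -/

/-! ### Entropy inequalities -/

/-- Gibbs' inequality in the form used for lower bounds on sums. -/
theorem sum_mul_log_sub_log_le_log_sum {ι : Type*} (s : Finset ι) (q y : ι → ℝ)
    (hq : ∀ i ∈ s, 0 ≤ q i) (hy : ∀ i ∈ s, 0 ≤ y i) (hqy : ∀ i ∈ s, q i ≠ 0 → 0 < y i)
    (hsum : ∑ i ∈ s, q i = 1) :
    ∑ i ∈ s, q i * (Real.log (y i) - Real.log (q i)) ≤ Real.log (∑ i ∈ s, y i) := by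
  classical
  set t := s.filter (fun i => q i ≠ 0)
  have hts : ∀ i ∈ t, i ∈ s ∧ q i ≠ 0 := fun i hi => by simpa [t] using hi
  have hpos : ∀ i ∈ t, 0 < q i := fun i hi => lt_of_le_of_ne (hq i (hts i hi).1) (hts i hi).2.symm
  have hypos : ∀ i ∈ t, 0 < y i := fun i hi => hqy i (hts i hi).1 (hts i hi).2
  have h1 : ∑ i ∈ t, q i = 1 := by
    rw [← hsum]
    exact Finset.sum_filter_ne_zero s
  have h2 : ∑ i ∈ s, q i * (Real.log (y i) - Real.log (q i))
      = ∑ i ∈ t, q i * (Real.log (y i) - Real.log (q i)) := by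
    symm
    apply Finset.sum_subset (Finset.filter_subset _ _)
    intro i hi hit
    have : q i = 0 := by
      by_contra h
      exact hit (Finset.mem_filter.2 ⟨hi, h⟩)
    simp [this]
  have hne : t.Nonempty := by
    by_contra h
    rw [Finset.not_nonempty_iff_eq_empty] at h
    simp [h] at h1
  have h3 := strictConcaveOn_log_Ioi.concaveOn.le_map_sum (t := t) (w := q)
    (p := fun i => y i / q i) (fun i hi => (hpos i hi).le) h1
    (fun i hi => div_pos (hypos i hi) (hpos i hi))
  simp only [smul_eq_mul] at h3
  have h4 : ∑ i ∈ t, q i * (y i / q i) = ∑ i ∈ t, y i :=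
    Finset.sum_congr rfl fun i hi => mul_div_cancel₀ _ (hpos i hi).ne'
  rw [h4] at h3
  rw [h2]
  calc _ = ∑ i ∈ t, q i * Real.log (y i / q i) :=
        Finset.sum_congr rfl fun i hi => by rw [Real.log_div (hypos i hi).ne' (hpos i hi).ne']
    _ ≤ _ := h3
    _ ≤ _ := Real.log_le_log (Finset.sum_pos hypos hne)
        (Finset.sum_le_sum_of_subset_of_nonneg (Finset.filter_subset _ _) fun i hi _ => hy i hi)

/-- Jensen's inequality for `x log x`: the uniform distribution of the mass `T` is extremal. -/
theorem sum_mul_log_sum_div_card_le {ι : Type*} [Fintype ι] (x : ι → ℝ) (hx : ∀ i, 0 ≤ x i)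
    {T : ℝ} (hT : ∑ i, x i = T) (hT0 : 0 < T) :
    T * (Real.log T - Real.log (Fintype.card ι)) ≤ ∑ i, x i * Real.log (x i) := by
  have hne : Nonempty ι := by
    by_contra h
    rw [not_nonempty_iff] at h
    simp at hT
    linarith
  have hc : (0 : ℝ) < Fintype.card ι := by exact_mod_cast Fintype.card_pos
  have h := Real.convexOn_mul_log.map_sum_le (t := Finset.univ)
    (w := fun _ : ι => (Fintype.card ι : ℝ)⁻¹) (p := x) (fun _ _ => by positivity)
    (by simp [hc.ne']) (fun i _ => hx i)
  simp only [smul_eq_mul, ← Finset.mul_sum, hT] at h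
  rw [← Real.log_div hT0.ne' hc.ne']
  rw [mul_assoc] at h
  have h' := le_of_mul_le_mul_left h (inv_pos.2 hc)
  rwa [inv_mul_eq_div] at h'

/-- Weighted AM–GM, obtained from Gibbs' inequality with the probabilities `f i / T`. -/
theorem mul_exp_sum_log_le {ι : Type*} [Fintype ι] (f k : ι → ℝ) (hf : ∀ i, 0 ≤ f i)
    (hk : ∀ i, f i ≠ 0 → 0 < k i) {T : ℝ} (hT : ∑ i, f i = T) (hT0 : 0 < T) :
    T * Real.exp ((∑ i, f i * Real.log (k i)) / T) ≤ ∑ i, f i * k i := by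
  have hfk : ∀ i, 0 ≤ f i * k i := fun i => by
    rcases eq_or_ne (f i) 0 with h | h
    · simp [h]
    · exact mul_nonneg (hf i) (hk i h).le
  have hpos : 0 < ∑ i, f i * k i := by
    have hex : ∃ i, f i ≠ 0 := by
      by_contra! h
      simp [h] at hT
      linarith
    obtain ⟨i, hi⟩ := hex
    exact Finset.sum_pos' (fun i _ => hfk i) ⟨i, Finset.mem_univ _,
      mul_pos (lt_of_le_of_ne (hf i) hi.symm) (hk i hi)⟩
  have h := sum_mul_log_sub_log_le_log_sum Finset.univ (fun i => f i / T) (fun i => f i * k i)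
    (fun i _ => div_nonneg (hf i) hT0.le) (fun i _ => hfk i)
    (fun i _ hi => by
      have : f i ≠ 0 := fun h => hi (by simp [h])
      exact mul_pos (lt_of_le_of_ne (hf i) this.symm) (hk i this))
    (by rw [← Finset.sum_div, hT, div_self hT0.ne'])
  have h2 : ∑ i, f i / T * (Real.log (f i * k i) - Real.log (f i / T))
      = (∑ i, f i * Real.log (k i)) / T + Real.log T := by
    have : Real.log T = ∑ i, f i / T * Real.log T := by
      rw [← Finset.sum_mul, ← Finset.sum_div, hT, div_self hT0.ne', one_mul]
    rw [this, Finset.sum_div, ← Finset.sum_add_distrib]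
    refine Finset.sum_congr rfl fun i _ => ?_
    rcases eq_or_ne (f i) 0 with h | h
    · simp [h]
    · rw [Real.log_mul h (hk i h).ne', Real.log_div h hT0.ne']
      ring
  rw [h2] at h
  have h3 := Real.exp_le_exp.2 h
  rwa [Real.exp_add, Real.exp_log hT0, Real.exp_log hpos, mul_comm] at h3

/-! ### Entropy of four-cycles in links -/

section LinkOperators

variable {V : Type*} [Fintype V]

/-- The number of edges through the pair formed by the first and the third vertex. -/
noncomputable def codeg (f : V → V → V → ℝ) (a c : V) : ℝ := ∑ b, f a b c

/-- Common neighbours of `b` and `b'` in the link of `c`, weighted by inverse degrees. -/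
noncomputable def cherryWeight (f : V → V → V → ℝ) (b b' c : V) : ℝ :=
  ∑ a, f a b c * f a b' c / codeg f a c

/-- The sum of `k` over the edges opposite to `ab` in the four-cycles of the link of `c`. -/
noncomputable def linkSquare (f k : V → V → V → ℝ) (a b c : V) : ℝ :=
  ∑ a', ∑ b', f a b c * f a' b c * f a b' c * f a' b' c * k a' b' c

/-- A symmetric Markov kernel on the edges of the link of `c`, supported on its four-cycles. -/
noncomputable def squareKernel (f : V → V → V → ℝ) (a b a' b' c : V) : ℝ :=
  f a b c * f a' b c * f a b' c * f a' b' c /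
    (codeg f a c * codeg f a' c * cherryWeight f b b' c)

variable {f : V → V → V → ℝ}

theorem squareKernel_swap (a b a' b' c : V) :
    squareKernel f a b a' b' c = squareKernel f a' b' a b c := by
  have : cherryWeight f b b' c = cherryWeight f b' b c := by
    simp only [cherryWeight, mul_comm]
  rw [squareKernel, squareKernel, this]
  ring

theorem codeg_nonneg (hf : ∀ a b c, 0 ≤ f a b c) (a c : V) : 0 ≤ codeg f a c :=
  Finset.sum_nonneg fun _ _ => hf _ _ _

theorem codeg_pos (hf : ∀ a b c, 0 ≤ f a b c) {a b c : V} (h : f a b c ≠ 0) : 0 < codeg f a c :=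
  Finset.sum_pos' (fun _ _ => hf _ _ _)
    ⟨b, Finset.mem_univ _, lt_of_le_of_ne (hf _ _ _) h.symm⟩

theorem cherryWeight_nonneg (hf : ∀ a b c, 0 ≤ f a b c) (b b' c : V) :
    0 ≤ cherryWeight f b b' c :=
  Finset.sum_nonneg fun _ _ => div_nonneg (mul_nonneg (hf _ _ _) (hf _ _ _)) (codeg_nonneg hf _ _)

theorem cherryWeight_pos (hf : ∀ a b c, 0 ≤ f a b c) {a b b' c : V} (h : f a b c ≠ 0)
    (h' : f a b' c ≠ 0) : 0 < cherryWeight f b b' c :=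
  Finset.sum_pos' (fun _ _ => div_nonneg (mul_nonneg (hf _ _ _) (hf _ _ _)) (codeg_nonneg hf _ _))
    ⟨a, Finset.mem_univ _, div_pos (mul_pos (lt_of_le_of_ne (hf _ _ _) h.symm)
      (lt_of_le_of_ne (hf _ _ _) h'.symm)) (codeg_pos hf h)⟩

theorem squareKernel_nonneg (hf : ∀ a b c, 0 ≤ f a b c) (a b a' b' c : V) :
    0 ≤ squareKernel f a b a' b' c := by
  have h1 := codeg_nonneg hf a c
  have h2 := codeg_nonneg hf a' c
  have h3 := cherryWeight_nonneg hf b b' c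
  have h4 := hf a b c
  have h5 := hf a' b c
  have h6 := hf a b' c
  have h7 := hf a' b' c
  unfold squareKernel
  positivity

/-- From an edge `ab`, the kernel picks `b'` uniformly among the neighbours of `a` in the link of
`c`, then `a'` among the common neighbours of `b` and `b'` with weight inverse to the degree. Both
choices have total probability one. -/
theorem sum_squareKernel (h01 : ∀ a b c, f a b c = 0 ∨ f a b c = 1) (a b c : V) :
    ∑ a', ∑ b', squareKernel f a b a' b' c = f a b c := by
  have hf : ∀ a b c, 0 ≤ f a b c := fun a b c => by rcases h01 a b c with h | h <;> simp [h]
  rcases h01 a b c with h | h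
  · simp [squareKernel, h]
  rw [Finset.sum_comm]
  have key : ∀ b', ∑ a', squareKernel f a b a' b' c = f a b' c / codeg f a c := by
    intro b'
    rcases h01 a b' c with h' | h'
    · simp [squareKernel, h']
    have hS : 0 < cherryWeight f b b' c :=
      cherryWeight_pos hf (a := a) (by simp [h]) (by simp [h'])
    have : ∀ a', squareKernel f a b a' b' c =
        (f a' b c * f a' b' c / codeg f a' c) * (1 / (codeg f a c * cherryWeight f b b' c)) := by
      intro a'
      rw [squareKernel, h, h', div_mul_div_comm]
      ring
    simp only [this]
    rw [← Finset.sum_mul, ← cherryWeight, h']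
    have := codeg_pos hf (a := a) (b := b) (c := c) (by simp [h])
    field_simp
  simp only [key]
  rw [← Finset.sum_div, ← codeg, h, div_self]
  exact (codeg_pos hf (a := a) (b := b) (c := c) (by simp [h])).ne'

theorem sum_squareKernel_ends (b b' c : V) :
    ∑ a, ∑ a', squareKernel f a b a' b' c = cherryWeight f b b' c := by
  have : ∀ a a', squareKernel f a b a' b' c =
      (f a b c * f a b' c / codeg f a c) * (f a' b c * f a' b' c / codeg f a' c) *
        (cherryWeight f b b' c)⁻¹ := by
    intro a a'
    rw [squareKernel, div_mul_div_comm, ← div_eq_mul_inv, div_div]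
    ring
  simp only [this]
  simp only [← Finset.sum_mul, ← Finset.mul_sum]
  rw [← cherryWeight]
  rcases eq_or_ne (cherryWeight f b b' c) 0 with h | h
  · simp [h]
  · field_simp

theorem sum_cherryWeight :
    ∑ b, ∑ b', ∑ c, cherryWeight f b b' c = ∑ a, ∑ b, ∑ c, f a b c := by
  have h1 : ∑ b, ∑ b', ∑ c, cherryWeight f b b' c
      = ∑ a, ∑ c, ∑ b, ∑ b', f a b c * f a b' c / codeg f a c := by
    simp only [cherryWeight]
    calc _ = ∑ b, ∑ b', ∑ a, ∑ c, f a b c * f a b' c / codeg f a c :=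
          Finset.sum_congr rfl fun b _ => Finset.sum_congr rfl fun b' _ => Finset.sum_comm
      _ = ∑ b, ∑ a, ∑ b', ∑ c, f a b c * f a b' c / codeg f a c :=
          Finset.sum_congr rfl fun b _ => Finset.sum_comm
      _ = ∑ a, ∑ b, ∑ c, ∑ b', f a b c * f a b' c / codeg f a c := by
          rw [Finset.sum_comm]
          exact Finset.sum_congr rfl fun a _ => Finset.sum_congr rfl fun b _ => Finset.sum_comm
      _ = _ := Finset.sum_congr rfl fun a _ => Finset.sum_comm
  rw [h1]
  refine Finset.sum_congr rfl fun a _ => ?_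
  rw [Finset.sum_comm (s := Finset.univ (α := V)) (t := Finset.univ (α := V))
    (f := fun b c => f a b c)]
  refine Finset.sum_congr rfl fun c _ => ?_
  simp only [← Finset.sum_div, ← Finset.mul_sum]
  rw [← Finset.sum_mul, ← codeg]
  -- Valid also for degree zero, where division by zero gives zero.
  exact mul_self_div_self _

theorem sum_log_codeg_ge (hf : ∀ a b c, 0 ≤ f a b c) {T : ℝ}
    (hT : ∑ a, ∑ b, ∑ c, f a b c = T) (hT0 : 0 < T) :
    T * (Real.log T - 2 * Real.log (Fintype.card V)) ≤
      ∑ a, ∑ b, ∑ c, f a b c * Real.log (codeg f a c) := by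
  have h := sum_mul_log_sum_div_card_le (fun x : V × V => codeg f x.1 x.2)
    (fun x => codeg_nonneg hf _ _) (T := T)
    (by
      rw [Fintype.sum_prod_type, ← hT]
      exact Finset.sum_congr rfl fun a _ => by
        simp only [codeg]
        exact Finset.sum_comm) hT0
  rw [Fintype.card_prod, Nat.cast_mul, ← sq, Real.log_pow] at h
  refine (h.trans_eq ?_)
  rw [Fintype.sum_prod_type]
  refine Finset.sum_congr rfl fun a _ => ?_
  rw [Finset.sum_comm]
  exact Finset.sum_congr rfl fun c _ => by rw [codeg, Finset.sum_mul]

theorem sum_cherryWeight_mul_log_ge (hf : ∀ a b c, 0 ≤ f a b c) {T : ℝ}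
    (hT : ∑ a, ∑ b, ∑ c, f a b c = T) (hT0 : 0 < T) :
    T * (Real.log T - 3 * Real.log (Fintype.card V)) ≤
      ∑ b, ∑ b', ∑ c, cherryWeight f b b' c * Real.log (cherryWeight f b b' c) := by
  have h := sum_mul_log_sum_div_card_le
    (fun x : V × V × V => cherryWeight f x.1 x.2.1 x.2.2)
    (fun x => cherryWeight_nonneg hf _ _ _) (T := T)
    (by
      rw [Fintype.sum_prod_type, ← hT, ← sum_cherryWeight]
      exact Finset.sum_congr rfl fun a _ => Fintype.sum_prod_type _) hT0
  rw [Fintype.card_prod, Fintype.card_prod, Nat.cast_mul, Nat.cast_mul, ← sq, ← pow_succ',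
    Real.log_pow] at h
  refine (h.trans_eq ?_)
  rw [Fintype.sum_prod_type]
  exact Finset.sum_congr rfl fun a _ => Fintype.sum_prod_type _

theorem linkSquare_pos (hf : ∀ a b c, 0 ≤ f a b c) {k : V → V → V → ℝ}
    (hk : ∀ a b c, f a b c ≠ 0 → 0 < k a b c) {a b c : V} (h : f a b c ≠ 0) :
    0 < linkSquare f k a b c := by
  have hnn : ∀ a' b', 0 ≤ f a b c * f a' b c * f a b' c * f a' b' c * k a' b' c := by
    intro a' b'
    rcases eq_or_ne (f a' b' c) 0 with h' | h'
    · simp [h']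
    · have := hk _ _ _ h'
      have h4 := hf a b c
      have h5 := hf a' b c
      have h6 := hf a b' c
      have h7 := hf a' b' c
      positivity
  have hp : 0 < f a b c := lt_of_le_of_ne (hf _ _ _) h.symm
  have := hk _ _ _ h
  exact Finset.sum_pos' (fun _ _ => Finset.sum_nonneg fun _ _ => hnn _ _)
    ⟨a, Finset.mem_univ _, Finset.sum_pos' (fun _ _ => hnn _ _)
      ⟨b, Finset.mem_univ _, by positivity⟩⟩

/-- Gibbs' inequality for the row of the kernel at `ab`. On the support all values of `f` are 1, so
minus the logarithm of the kernel is the sum of the logarithms of its three denominators. -/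
theorem mul_log_linkSquare_ge (h01 : ∀ a b c, f a b c = 0 ∨ f a b c = 1) {k : V → V → V → ℝ}
    (hk : ∀ a b c, f a b c ≠ 0 → 0 < k a b c) (a b c : V) :
    ∑ a', ∑ b', squareKernel f a b a' b' c * (Real.log (k a' b' c) + Real.log (codeg f a c)
        + Real.log (codeg f a' c) + Real.log (cherryWeight f b b' c)) ≤
      f a b c * Real.log (linkSquare f k a b c) := by
  have hf : ∀ a b c, 0 ≤ f a b c := fun a b c => by rcases h01 a b c with h | h <;> simp [h]
  rcases h01 a b c with h | h
  · simp [squareKernel, h]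
  have hsupp : ∀ a' b', squareKernel f a b a' b' c ≠ 0 →
      f a' b c = 1 ∧ f a b' c = 1 ∧ f a' b' c = 1 := by
    intro a' b' hne
    refine ⟨(h01 _ _ _).resolve_left ?_, (h01 _ _ _).resolve_left ?_,
      (h01 _ _ _).resolve_left ?_⟩ <;> intro h0 <;> exact hne (by simp [squareKernel, h0])
  have hG := sum_mul_log_sub_log_le_log_sum (Finset.univ : Finset (V × V))
    (fun x => squareKernel f a b x.1 x.2 c)
    (fun x => f a b c * f x.1 b c * f a x.2 c * f x.1 x.2 c * k x.1 x.2 c)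
    (fun x _ => squareKernel_nonneg hf _ _ _ _ _)
    (fun x _ => by
      rcases h01 x.1 x.2 c with h' | h'
      · simp [h']
      · have := hk x.1 x.2 c (by simp [h'])
        exact mul_nonneg (mul_nonneg (mul_nonneg (mul_nonneg (hf _ _ _) (hf _ _ _)) (hf _ _ _))
          (hf _ _ _)) this.le)
    (fun x _ hx => by
      obtain ⟨h1, h2, h3⟩ := hsupp _ _ hx
      have := hk x.1 x.2 c (by simp [h3])
      simpa [h, h1, h2, h3] using this)
    (by rw [Fintype.sum_prod_type, sum_squareKernel h01, h])
  rw [Fintype.sum_prod_type, Fintype.sum_prod_type] at hG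
  rw [h, one_mul, linkSquare]
  refine le_trans (le_of_eq ?_) hG
  refine Finset.sum_congr rfl fun a' _ => Finset.sum_congr rfl fun b' _ => ?_
  rcases eq_or_ne (squareKernel f a b a' b' c) 0 with h0 | h0
  · simp [h0]
  obtain ⟨h1, h2, h3⟩ := hsupp _ _ h0
  have hd := codeg_pos hf (a := a) (b := b) (c := c) (by simp [h])
  have hd' := codeg_pos hf (a := a') (b := b) (c := c) (by simp [h1])
  have hS := cherryWeight_pos hf (a := a) (b := b) (b' := b') (c := c) (by simp [h]) (by simp [h2])
  congr 1
  have : Real.log (squareKernel f a b a' b' c) = - (Real.log (codeg f a c)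
      + Real.log (codeg f a' c) + Real.log (cherryWeight f b b' c)) := by
    rw [squareKernel, h, h1, h2, h3, Real.log_div (by norm_num) (by positivity),
      Real.log_mul (by positivity) hS.ne', Real.log_mul hd.ne' hd'.ne']
    simp
  rw [this, h, h1, h2, h3]
  ring_nf

theorem sum_comm_edges (F : V → V → V → V → V → ℝ) :
    ∑ a, ∑ b, ∑ c, ∑ a', ∑ b', F a b c a' b' = ∑ a', ∑ b', ∑ c, ∑ a, ∑ b, F a b c a' b' := by
  have h := Finset.sum_comm (s := (Finset.univ : Finset (V × V)))
    (t := (Finset.univ : Finset (V × V))) (f := fun x y => ∑ c, F x.1 x.2 c y.1 y.2)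
  simp only [Fintype.sum_prod_type] at h
  have h1 : ∀ a b, ∑ c, ∑ a', ∑ b', F a b c a' b' = ∑ a', ∑ b', ∑ c, F a b c a' b' := by
    intro a b
    rw [Finset.sum_comm]
    exact Finset.sum_congr rfl fun a' _ => Finset.sum_comm
  have h2 : ∀ a' b', ∑ c, ∑ a, ∑ b, F a b c a' b' = ∑ a, ∑ b, ∑ c, F a b c a' b' := by
    intro a' b'
    rw [Finset.sum_comm]
    exact Finset.sum_congr rfl fun a' _ => Finset.sum_comm
  simp only [h1, h2, h]

theorem sum_comm_ends (F : V → V → V → V → V → ℝ) :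
    ∑ a, ∑ b, ∑ c, ∑ a', ∑ b', F a b c a' b' = ∑ b, ∑ b', ∑ c, ∑ a, ∑ a', F a b c a' b' := by
  rw [Finset.sum_comm]
  refine Finset.sum_congr rfl fun b _ => ?_
  calc _ = ∑ c, ∑ a, ∑ b', ∑ a', F a b c a' b' := by
        rw [Finset.sum_comm]
        exact Finset.sum_congr rfl fun c _ => Finset.sum_congr rfl fun a _ => Finset.sum_comm
    _ = ∑ c, ∑ b', ∑ a, ∑ a', F a b c a' b' :=
        Finset.sum_congr rfl fun c _ => Finset.sum_comm
    _ = _ := Finset.sum_comm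

/-- Summed over all edges, the symmetric kernel has both marginals equal to `f`, so the average of
`log k` is unchanged. The two degree terms give `log T - 2 log n` each and the cherry term gives
`log T - 3 log n`, all by Jensen. -/
theorem sum_log_linkSquare_ge (h01 : ∀ a b c, f a b c = 0 ∨ f a b c = 1) {T : ℝ}
    (hT : ∑ a, ∑ b, ∑ c, f a b c = T) (hT0 : 0 < T) {k : V → V → V → ℝ}
    (hk : ∀ a b c, f a b c ≠ 0 → 0 < k a b c) :
    (∑ a, ∑ b, ∑ c, f a b c * Real.log (k a b c))
        + T * (3 * Real.log T - 7 * Real.log (Fintype.card V)) ≤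
      ∑ a, ∑ b, ∑ c, f a b c * Real.log (linkSquare f k a b c) := by
  have hf : ∀ a b c, 0 ≤ f a b c := fun a b c => by rcases h01 a b c with h | h <;> simp [h]
  have hmain := Finset.sum_le_sum fun a (_ : a ∈ Finset.univ) =>
    Finset.sum_le_sum fun b (_ : b ∈ Finset.univ) =>
      Finset.sum_le_sum fun c (_ : c ∈ Finset.univ) => mul_log_linkSquare_ge h01 hk a b c
  refine le_trans ?_ hmain
  simp only [mul_add, Finset.sum_add_distrib]
  have hcol : ∀ g : V → V → V → ℝ,
      ∑ a, ∑ b, ∑ c, ∑ a', ∑ b', squareKernel f a b a' b' c * g a' b' c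
        = ∑ a, ∑ b, ∑ c, f a b c * g a b c := by
    intro g
    rw [sum_comm_edges]
    refine Finset.sum_congr rfl fun a' _ => Finset.sum_congr rfl fun b' _ =>
      Finset.sum_congr rfl fun c _ => ?_
    simp only [← Finset.sum_mul, squareKernel_swap _ _ a' b' c]
    rw [sum_squareKernel h01]
  have hrow : ∀ g : V → V → V → ℝ,
      ∑ a, ∑ b, ∑ c, ∑ a', ∑ b', squareKernel f a b a' b' c * g a b c
        = ∑ a, ∑ b, ∑ c, f a b c * g a b c := by
    intro g
    simp only [← Finset.sum_mul, sum_squareKernel h01]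
  have hend : ∑ a, ∑ b, ∑ c, ∑ a', ∑ b',
      squareKernel f a b a' b' c * Real.log (cherryWeight f b b' c)
        = ∑ b, ∑ b', ∑ c, cherryWeight f b b' c * Real.log (cherryWeight f b b' c) := by
    rw [sum_comm_ends]
    simp only [← Finset.sum_mul, sum_squareKernel_ends]
  rw [hcol fun a b c => Real.log (k a b c), hrow fun a b c => Real.log (codeg f a c),
    hcol fun a b c => Real.log (codeg f a c), hend]
  have h1 := sum_log_codeg_ge hf hT hT0
  have h2 := sum_cherryWeight_mul_log_ge hf hT hT0
  linarith

/-- Summing out the third vertex. -/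
theorem sum_log_link_sum_ge (h01 : ∀ a b c, f a b c = 0 ∨ f a b c = 1)
    (hsymm : ∀ a b c, f a b c = f a c b) {T : ℝ}
    (hT : ∑ a, ∑ b, ∑ c, f a b c = T) (hT0 : 0 < T) {k : V → V → V → ℝ}
    (hk : ∀ a b c, f a b c ≠ 0 → 0 < k a b c) :
    (∑ a, ∑ b, ∑ c, f a b c * Real.log (k a b c))
        + T * (Real.log T - 2 * Real.log (Fintype.card V)) ≤
      ∑ a, ∑ b, ∑ c, f a b c * Real.log (∑ c', f a b c' * k a b c') := by
  have hf : ∀ a b c, 0 ≤ f a b c := fun a b c => by rcases h01 a b c with h | h <;> simp [h]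
  have hd : ∀ a b, codeg f a b = ∑ c, f a b c := fun a b =>
    Finset.sum_congr rfl fun c _ => hsymm a c b
  have h1 := sum_log_codeg_ge hf hT hT0
  have h2 : ∑ a, ∑ b, ∑ c, f a b c * Real.log (codeg f a c)
      = ∑ a, ∑ b, ∑ c, f a b c * Real.log (codeg f a b) := by
    refine Finset.sum_congr rfl fun a _ => ?_
    rw [Finset.sum_comm]
    exact Finset.sum_congr rfl fun b _ => Finset.sum_congr rfl fun c _ => by rw [hsymm]
  rw [h2] at h1
  refine (add_le_add_right h1 _).trans ?_
  rw [← Finset.sum_add_distrib]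
  refine Finset.sum_le_sum fun a _ => ?_
  rw [← Finset.sum_add_distrib]
  refine Finset.sum_le_sum fun b _ => ?_
  -- For a fixed pair the claim is AM–GM over its third vertices; pairs in no edge contribute
  -- nothing.
  rw [← Finset.sum_mul, ← Finset.sum_mul, ← hd]
  rcases (codeg_nonneg hf a b).eq_or_lt with h0 | h0
  · have : ∀ c, f a b c = 0 := fun c => by
      have h := h0.trans (hd a b)
      exact (Finset.sum_eq_zero_iff_of_nonneg fun _ _ => hf _ _ _).1 h.symm c (Finset.mem_univ _)
    simp [this, ← h0]
  have hJ := mul_exp_sum_log_le (f a b) (k a b) (hf a b) (hk a b) (hd a b).symm h0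
  have hlog := Real.log_le_log (by positivity) hJ
  rw [Real.log_mul h0.ne' (Real.exp_pos _).ne', Real.log_exp] at hlog
  have := mul_le_mul_of_nonneg_left hlog h0.le
  rw [mul_add, mul_div_cancel₀ _ h0.ne'] at this
  linarith

end LinkOperators

/-! ### Symmetric minorants of the tight-walk matrix -/

open Matrix

section Matrices

theorem Matrix.mul_le_mul_entries {m n o : Type*} [Fintype n] {A A' : Matrix m n ℝ}
    {B B' : Matrix n o ℝ} (hA : ∀ i j, 0 ≤ A i j) (hB : ∀ i j, 0 ≤ B i j)
    (hAA : ∀ i j, A i j ≤ A' i j) (hBB : ∀ i j, B i j ≤ B' i j) (i : m) (j : o) :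
    0 ≤ (A * B) i j ∧ (A * B) i j ≤ (A' * B') i j := by
  simp only [Matrix.mul_apply]
  exact ⟨Finset.sum_nonneg fun k _ => mul_nonneg (hA _ _) (hB _ _),
    Finset.sum_le_sum fun k _ => mul_le_mul (hAA _ _) (hBB _ _) (hB _ _)
      ((hA _ _).trans (hAA _ _))⟩

theorem Matrix.pow_le_pow_entries {n : Type*} [Fintype n] [DecidableEq n] {A A' : Matrix n n ℝ}
    (hA : ∀ i j, 0 ≤ A i j) (hAA : ∀ i j, A i j ≤ A' i j) (m : ℕ) (i j : n) :
    0 ≤ (A ^ m) i j ∧ (A ^ m) i j ≤ (A' ^ m) i j := by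
  induction m generalizing i j with
  | zero =>
    simp only [pow_zero, le_refl, and_true, Matrix.one_apply]
    split_ifs <;> norm_num
  | succ m ih =>
    rw [pow_succ, pow_succ]
    exact Matrix.mul_le_mul_entries (fun i j => (ih i j).1) hA (fun i j => (ih i j).2) hAA i j

/-- Cauchy–Schwarz, the trace being the sum of the squared entries. -/
theorem Matrix.sq_sum_le_card_mul_trace_mul_transpose {m n : Type*} [Fintype m] [Fintype n]
    (A : Matrix m n ℝ) :
    (∑ i, ∑ j, A i j) ^ 2 ≤ (Fintype.card m * Fintype.card n : ℝ) * (A * Aᵀ).trace := by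
  have h := sq_sum_le_card_mul_sum_sq (s := (Finset.univ : Finset (m × n)))
    (f := fun x => A x.1 x.2)
  rw [Fintype.sum_prod_type, Fintype.sum_prod_type, Finset.card_univ, Fintype.card_prod,
    Nat.cast_mul] at h
  refine h.trans_eq ?_
  congr 1
  simp only [Matrix.trace, Matrix.diag, Matrix.mul_apply, Matrix.transpose_apply, sq]

variable {V : Type*} [Fintype V]

/-- The weight of the ways to pass from the pair `s` to the pair `t` by three steps of a tight
walk. -/
def tightStep (f : V → V → V → ℝ) : Matrix (V × V) (V × V) ℝ :=
  fun s t => ∑ c, f s.1 s.2 c * f t.1 s.2 c * f t.1 t.2 c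

/-- The symmetric part of `tightStep`: the pairs span a four-cycle in the link of a vertex. -/
def squareStep (f : V → V → V → ℝ) : Matrix (V × V) (V × V) ℝ :=
  fun s t => ∑ c, f s.1 s.2 c * f t.1 s.2 c * f s.1 t.2 c * f t.1 t.2 c

/-- One half, under reflection, of nine consecutive steps of a tight walk. -/
def halfBlock (f : V → V → V → ℝ) : Matrix (V × V) (V × V × V) ℝ :=
  fun s w => ∑ c, f s.1 s.2 c * ∑ b, f s.1 s.2 c * f w.2.1 s.2 c * f s.1 b c * f w.2.1 b c *
    (f w.2.1 c b * f w.2.2 c b * f w.2.1 w.1 b * f w.2.2 w.1 b)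

/-- The sum of `k` over the edges through a pair. -/
def linkSum (f k : V → V → V → ℝ) (s : V × V) : ℝ := ∑ c, f s.1 s.2 c * k s.1 s.2 c

variable {f : V → V → V → ℝ}

theorem squareStep_transpose : (squareStep f)ᵀ = squareStep f := by
  ext s t
  simp only [squareStep, Matrix.transpose_apply]
  exact Finset.sum_congr rfl fun c _ => by ring

theorem squareStep_nonneg (hf : ∀ a b c, 0 ≤ f a b c) (s t : V × V) : 0 ≤ squareStep f s t :=
  Finset.sum_nonneg fun _ _ => mul_nonneg (mul_nonneg (mul_nonneg (hf _ _ _) (hf _ _ _))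
    (hf _ _ _)) (hf _ _ _)

theorem tightStep_nonneg (hf : ∀ a b c, 0 ≤ f a b c) (s t : V × V) : 0 ≤ tightStep f s t :=
  Finset.sum_nonneg fun _ _ => mul_nonneg (mul_nonneg (hf _ _ _) (hf _ _ _)) (hf _ _ _)

theorem halfBlock_nonneg (hf : ∀ a b c, 0 ≤ f a b c) (s : V × V) (w : V × V × V) :
    0 ≤ halfBlock f s w := by
  have h := fun a b a' b' c => mul_nonneg (hf a b c) (hf a' b' c)
  exact Finset.sum_nonneg fun c _ => mul_nonneg (hf _ _ _) (Finset.sum_nonneg fun b _ =>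
    mul_nonneg (mul_nonneg (mul_nonneg (h _ _ _ _ _) (hf _ _ _)) (hf _ _ _))
      (mul_nonneg (mul_nonneg (h _ _ _ _ _) (hf _ _ _)) (hf _ _ _)))

theorem squareStep_le_tightStep (hf : ∀ a b c, 0 ≤ f a b c) (hf1 : ∀ a b c, f a b c ≤ 1)
    (s t : V × V) : squareStep f s t ≤ tightStep f s t := by
  refine Finset.sum_le_sum fun c _ => ?_
  calc _ = (f s.1 s.2 c * f t.1 s.2 c * f t.1 t.2 c) * f s.1 t.2 c := by ring
    _ ≤ _ := mul_le_of_le_one_right (mul_nonneg (mul_nonneg (hf _ _ _) (hf _ _ _)) (hf _ _ _))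
      (hf1 _ _ _)

/-- Turns a matrix step into the two operations controlled by the entropy bounds. The additional
factor `f` in the outer `linkSum` is harmless because `f` is 0 or 1. -/
theorem squareStep_mulVec_linkSum (h01 : ∀ a b c, f a b c = 0 ∨ f a b c = 1)
    (k : V → V → V → ℝ) :
    squareStep f *ᵥ linkSum f k
      = linkSum f (linkSquare f fun a b _ => linkSum f k (a, b)) := by
  ext s
  simp only [Matrix.mulVec, dotProduct, squareStep, Finset.sum_mul]
  rw [Finset.sum_comm, linkSum]
  refine Finset.sum_congr rfl fun c _ => ?_
  rw [Fintype.sum_prod_type, linkSquare]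
  rcases h01 s.1 s.2 c with h | h <;> simp [h]

theorem squareStep_mulVec_one (h01 : ∀ a b c, f a b c = 0 ∨ f a b c = 1) :
    squareStep f *ᵥ (fun _ => 1) = linkSum f (linkSquare f fun _ _ _ => 1) := by
  ext s
  simp only [Matrix.mulVec, dotProduct, squareStep, mul_one]
  rw [Finset.sum_comm, linkSum]
  refine Finset.sum_congr rfl fun c _ => ?_
  rw [Fintype.sum_prod_type, linkSquare]
  rcases h01 s.1 s.2 c with h | h <;> simp [h]

theorem halfBlock_mulVec_one :
    halfBlock f *ᵥ (fun _ => 1)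
      = linkSum f (linkSquare f fun a b c => linkSquare f (fun _ _ _ => 1) a c b) := by
  ext s
  simp only [Matrix.mulVec, dotProduct, halfBlock, mul_one]
  rw [Finset.sum_comm, linkSum]
  refine Finset.sum_congr rfl fun c _ => ?_
  rw [← Finset.mul_sum]
  congr 1
  simp only [linkSquare, Finset.mul_sum, mul_one, Fintype.sum_prod_type]
  rw [Finset.sum_comm]
  refine Finset.sum_congr rfl fun a' _ => ?_
  calc _ = ∑ w, ∑ b, ∑ a, f s.1 s.2 c * f a' s.2 c * f s.1 b c * f a' b c *
        (f a' c b * f a c b * f a' w b * f a w b) :=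
        Finset.sum_congr rfl fun w _ => Finset.sum_comm
    _ = ∑ b, ∑ w, ∑ a, f s.1 s.2 c * f a' s.2 c * f s.1 b c * f a' b c *
        (f a' c b * f a c b * f a' w b * f a w b) := Finset.sum_comm
    _ = _ := Finset.sum_congr rfl fun b _ => Finset.sum_comm

theorem halfBlock_le_left (hf : ∀ a b c, 0 ≤ f a b c) (hf1 : ∀ a b c, f a b c ≤ 1)
    (h₂ : ∀ a b c, f a b c = f a c b) (s : V × V) (c₁ a₁ a₂ : V) :
    halfBlock f s (c₁, a₁, a₂) ≤
      ∑ b, tightStep f s (a₁, b) * (f a₁ b c₁ * f a₂ b c₁) := by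
  simp only [tightStep, Finset.sum_mul, halfBlock, Finset.mul_sum]
  rw [Finset.sum_comm]
  refine Finset.sum_le_sum fun b _ => Finset.sum_le_sum fun c _ => ?_
  have h0 : 0 ≤ f s.1 s.2 c * f a₁ s.2 c * f a₁ b c * (f a₁ b c₁ * f a₂ b c₁) :=
    mul_nonneg (mul_nonneg (mul_nonneg (hf _ _ _) (hf _ _ _)) (hf _ _ _))
      (mul_nonneg (hf _ _ _) (hf _ _ _))
  have h1 : f s.1 s.2 c * f s.1 b c * f a₁ c b * f a₂ c b ≤ 1 := by
    have h := hf1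
    exact mul_le_one₀ (mul_le_one₀ (mul_le_one₀ (h _ _ _) (hf _ _ _) (h _ _ _)) (hf _ _ _)
      (h _ _ _)) (hf _ _ _) (h _ _ _)
  refine le_trans (le_of_eq ?_) (mul_le_of_le_one_right h0 h1)
  rw [h₂ a₁ b c₁, h₂ a₂ b c₁]
  ring

theorem halfBlock_le_right (hf : ∀ a b c, 0 ≤ f a b c) (hf1 : ∀ a b c, f a b c ≤ 1)
    (h₂ : ∀ a b c, f a b c = f a c b) (s : V × V) (c₁ a₁ a₂ : V) :
    halfBlock f s (c₁, a₁, a₂) ≤ ∑ b, f a₂ b c₁ * tightStep f (a₂, b) s := by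
  simp only [tightStep, Finset.mul_sum, halfBlock]
  rw [Finset.sum_comm]
  refine Finset.sum_le_sum fun b _ => Finset.sum_le_sum fun c _ => ?_
  have h0 : 0 ≤ f a₂ b c₁ * (f a₂ b c * f s.1 b c * f s.1 s.2 c) :=
    mul_nonneg (hf _ _ _) (mul_nonneg (mul_nonneg (hf _ _ _) (hf _ _ _)) (hf _ _ _))
  have h1 : f s.1 s.2 c * f a₁ s.2 c * f a₁ b c * f a₁ c b * f a₁ b c₁ ≤ 1 := by
    have h := hf1
    exact mul_le_one₀ (mul_le_one₀ (mul_le_one₀ (mul_le_one₀ (h _ _ _) (hf _ _ _) (h _ _ _))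
      (hf _ _ _) (h _ _ _)) (hf _ _ _) (h _ _ _)) (hf _ _ _) (h _ _ _)
  refine le_trans (le_of_eq ?_) (mul_le_of_le_one_right h0 h1)
  rw [h₂ a₁ b c₁, h₂ a₂ b c₁, h₂ a₂ b c]
  ring

/-- Cut the walk `s, c, a₁, b, c₁, a₂, b', c', t` at the triple `(c₁, a₁, a₂)`. Once this triple is
fixed, the part with `b, c` and the part with `b', c'` separate, and adding edges turns each into
the same function `halfBlock` of its end pair. -/
theorem halfBlock_mul_transpose_le [DecidableEq V] (hf : ∀ a b c, 0 ≤ f a b c)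
    (hf1 : ∀ a b c, f a b c ≤ 1) (h₂ : ∀ a b c, f a b c = f a c b) (s t : V × V) :
    (halfBlock f * (halfBlock f)ᵀ) s t ≤ (tightStep f ^ 3) s t := by
  have h3 : (tightStep f ^ 3) s t = ∑ c₁, ∑ a₁, ∑ a₂,
      (∑ b, tightStep f s (a₁, b) * (f a₁ b c₁ * f a₂ b c₁)) *
        (∑ b, f a₂ b c₁ * tightStep f (a₂, b) t) := by
    have e1 : (tightStep f ^ 3) s t = ∑ a₁, ∑ b₁, ∑ a₂, ∑ b₂, ∑ c₁,
        tightStep f s (a₁, b₁) * (f a₁ b₁ c₁ * f a₂ b₁ c₁) *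
          (f a₂ b₂ c₁ * tightStep f (a₂, b₂) t) := by
      rw [pow_succ', pow_succ', pow_one, Matrix.mul_apply, Fintype.sum_prod_type]
      refine Finset.sum_congr rfl fun a₁ _ => Finset.sum_congr rfl fun b₁ _ => ?_
      rw [Matrix.mul_apply, Fintype.sum_prod_type, Finset.mul_sum]
      refine Finset.sum_congr rfl fun a₂ _ => ?_
      rw [Finset.mul_sum]
      refine Finset.sum_congr rfl fun b₂ _ => ?_
      rw [show tightStep f (a₁, b₁) (a₂, b₂) = ∑ c, f a₁ b₁ c * f a₂ b₁ c * f a₂ b₂ c from rfl,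
        Finset.sum_mul, Finset.mul_sum]
      exact Finset.sum_congr rfl fun c _ => by ring
    rw [e1]
    simp only [Finset.sum_mul_sum]
    calc _ = ∑ a₁, ∑ a₂, ∑ b₁, ∑ b₂, ∑ c₁,
        tightStep f s (a₁, b₁) * (f a₁ b₁ c₁ * f a₂ b₁ c₁) *
          (f a₂ b₂ c₁ * tightStep f (a₂, b₂) t) :=
          Finset.sum_congr rfl fun _ _ => Finset.sum_comm
      _ = ∑ a₁, ∑ a₂, ∑ c₁, ∑ b₁, ∑ b₂,
        tightStep f s (a₁, b₁) * (f a₁ b₁ c₁ * f a₂ b₁ c₁) *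
          (f a₂ b₂ c₁ * tightStep f (a₂, b₂) t) := by
          refine Finset.sum_congr rfl fun _ _ => Finset.sum_congr rfl fun _ _ => ?_
          rw [Finset.sum_congr rfl fun _ _ => Finset.sum_comm, Finset.sum_comm]
      _ = ∑ a₁, ∑ c₁, ∑ a₂, ∑ b₁, ∑ b₂,
        tightStep f s (a₁, b₁) * (f a₁ b₁ c₁ * f a₂ b₁ c₁) *
          (f a₂ b₂ c₁ * tightStep f (a₂, b₂) t) :=
          Finset.sum_congr rfl fun _ _ => Finset.sum_comm
      _ = _ := Finset.sum_comm
  rw [h3, Matrix.mul_apply]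
  simp only [Fintype.sum_prod_type, Matrix.transpose_apply]
  refine Finset.sum_le_sum fun c₁ _ => Finset.sum_le_sum fun a₁ _ =>
    Finset.sum_le_sum fun a₂ _ => ?_
  exact mul_le_mul (halfBlock_le_left hf hf1 h₂ _ _ _ _) (halfBlock_le_right hf hf1 h₂ _ _ _ _)
    (halfBlock_nonneg hf _ _) ((halfBlock_nonneg hf _ _).trans (halfBlock_le_left hf hf1 h₂ _ _ _ _))

/-- Walks along four-cycles in links are at least as numerous as in a random hypergraph. -/
theorem sum_squareStep_pow_mulVec_ge [DecidableEq V] (h01 : ∀ a b c, f a b c = 0 ∨ f a b c = 1)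
    (h₂ : ∀ a b c, f a b c = f a c b) {T : ℝ} (hT : ∑ a, ∑ b, ∑ c, f a b c = T) (hT0 : 0 < T)
    (hV : 0 < Fintype.card V) {k : V → V → V → ℝ} (hk : ∀ a b c, f a b c ≠ 0 → 0 < k a b c)
    {x : ℝ} (hx : 0 < x) (hkx : T * Real.log x ≤ ∑ a, ∑ b, ∑ c, f a b c * Real.log (k a b c))
    (j : ℕ) :
    T * x * (T ^ 4 / (Fintype.card V : ℝ) ^ 9) ^ j ≤
      ∑ s, (squareStep f ^ j *ᵥ linkSum f k) s := by
  have hf : ∀ a b c, 0 ≤ f a b c := fun a b c => by rcases h01 a b c with h | h <;> simp [h]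
  have hn : (0 : ℝ) < Fintype.card V := by exact_mod_cast hV
  induction j generalizing k x with
  | zero =>
    have h := mul_exp_sum_log_le (fun y : V × V × V => f y.1 y.2.1 y.2.2)
      (fun y => k y.1 y.2.1 y.2.2) (fun _ => hf _ _ _) (fun _ => hk _ _ _) (T := T)
      (by simpa only [Fintype.sum_prod_type] using hT) hT0
    simp only [Fintype.sum_prod_type] at h
    simp only [pow_zero, mul_one, Matrix.one_mulVec, Fintype.sum_prod_type, linkSum]
    refine le_trans (mul_le_mul_of_nonneg_left ?_ hT0.le) h
    rw [← Real.log_le_iff_le_exp hx, le_div_iff₀ hT0, mul_comm]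
    exact hkx
  | succ j ih =>
    have hr : ∀ a b c, f a b c ≠ 0 → 0 < linkSum f k (a, b) := by
      intro a b c h
      refine Finset.sum_pos' (fun c _ => ?_) ⟨c, Finset.mem_univ _,
        mul_pos (lt_of_le_of_ne (hf _ _ _) h.symm) (hk _ _ _ h)⟩
      rcases eq_or_ne (f a b c) 0 with h | h
      · simp [h]
      · exact mul_nonneg (hf _ _ _) (hk _ _ _ h).le
    have h1 := sum_log_link_sum_ge h01 h₂ hT hT0 hk
    have h2 := sum_log_linkSquare_ge h01 hT hT0 (k := fun a b _ => linkSum f k (a, b)) hr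
    -- One step of `S` multiplies the geometric mean of the weight by at least `T / n ^ 2` from
    -- `linkSum` and `T ^ 3 / n ^ 7` from `linkSquare`.
    have h3 := ih (k := linkSquare f fun a b _ => linkSum f k (a, b))
      (fun a b c h => linkSquare_pos hf hr h)
      (x := x * (T ^ 4 / (Fintype.card V : ℝ) ^ 9)) (by positivity) (by
        rw [Real.log_mul hx.ne' (by positivity), Real.log_div (by positivity) (by positivity),
          Real.log_pow, Real.log_pow]
        simp only [linkSum] at h2 ⊢
        push_cast
        linarith)
    rw [pow_succ (squareStep f), ← Matrix.mulVec_mulVec, squareStep_mulVec_linkSum h01]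
    refine le_trans (le_of_eq ?_) h3
    ring

theorem trace_tightStep_pow_even_ge [DecidableEq V] (h01 : ∀ a b c, f a b c = 0 ∨ f a b c = 1)
    (h₂ : ∀ a b c, f a b c = f a c b) {T : ℝ} (hT : ∑ a, ∑ b, ∑ c, f a b c = T) (hT0 : 0 < T)
    (hV : 0 < Fintype.card V) (j : ℕ) :
    (T / (Fintype.card V : ℝ) ^ 3) ^ (8 * (j + 1)) * (Fintype.card V : ℝ) ^ (6 * (j + 1)) ≤
      (tightStep f ^ (2 * (j + 1))).trace := by
  have hf : ∀ a b c, 0 ≤ f a b c := fun a b c => by rcases h01 a b c with h | h <;> simp [h]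
  have hf1 : ∀ a b c, f a b c ≤ 1 := fun a b c => by rcases h01 a b c with h | h <;> simp [h]
  have hn : (0 : ℝ) < Fintype.card V := by exact_mod_cast hV
  set n : ℝ := (Fintype.card V : ℝ) with hn'
  have hlog := sum_log_linkSquare_ge h01 hT hT0 (k := fun _ _ _ => 1) (fun _ _ _ _ => one_pos)
  have h1 := sum_squareStep_pow_mulVec_ge h01 h₂ hT hT0 hV
    (k := linkSquare f fun _ _ _ => 1) (fun a b c h => linkSquare_pos hf (fun _ _ _ _ => one_pos) h)
    (x := T ^ 3 / n ^ 7) (by positivity) (by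
      rw [Real.log_div (by positivity) (by positivity), Real.log_pow, Real.log_pow]
      simp only [Real.log_one, mul_zero, Finset.sum_const_zero, zero_add] at hlog
      exact_mod_cast hlog) j
  rw [← hn', ← squareStep_mulVec_one h01, Matrix.mulVec_mulVec, ← pow_succ] at h1
  simp only [Matrix.mulVec, dotProduct, mul_one] at h1
  have h2 := Matrix.sq_sum_le_card_mul_trace_mul_transpose (squareStep f ^ (j + 1))
  rw [Matrix.transpose_pow, squareStep_transpose, ← pow_add, ← two_mul, Fintype.card_prod,
    Nat.cast_mul, ← hn'] at h2
  have h3 : (squareStep f ^ (2 * (j + 1))).trace ≤ (tightStep f ^ (2 * (j + 1))).trace :=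
    Finset.sum_le_sum fun i _ => (Matrix.pow_le_pow_entries (squareStep_nonneg hf)
      (squareStep_le_tightStep hf hf1) _ i i).2
  refine le_trans ?_ h3
  rw [← mul_le_mul_iff_right₀ (show 0 < n * n * (n * n) by positivity)]
  refine le_trans ?_ h2
  refine le_trans (le_of_eq ?_) (pow_le_pow_left₀ (by positivity) h1 2)
  -- In terms of `p`, the squared total is `(p ^ 4 * n ^ 5 * (p ^ 4 * n ^ 3) ^ j) ^ 2`;
  -- Cauchy–Schwarz costs `n ^ 4`.
  obtain ⟨p, hp⟩ : ∃ p, T = p * n ^ 3 := ⟨T / n ^ 3, by field_simp⟩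
  have e1 : T / n ^ 3 = p := by rw [hp]; field_simp
  have e2 : T ^ 3 / n ^ 7 = p ^ 3 * n ^ 2 := by rw [hp]; field_simp
  have e3 : T ^ 4 / n ^ 9 = p ^ 4 * n ^ 3 := by rw [hp]; field_simp
  rw [e1, e2, e3, hp]
  ring

theorem trace_tightStep_pow_odd_ge [DecidableEq V] (h01 : ∀ a b c, f a b c = 0 ∨ f a b c = 1)
    (h₂ : ∀ a b c, f a b c = f a c b) {T : ℝ} (hT : ∑ a, ∑ b, ∑ c, f a b c = T) (hT0 : 0 < T)
    (hV : 0 < Fintype.card V) (j : ℕ) :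
    (T / (Fintype.card V : ℝ) ^ 3) ^ (8 * j + 14) * (Fintype.card V : ℝ) ^ (6 * j + 9) ≤
      (tightStep f ^ (2 * j + 3)).trace := by
  have hf : ∀ a b c, 0 ≤ f a b c := fun a b c => by rcases h01 a b c with h | h <;> simp [h]
  have hf1 : ∀ a b c, f a b c ≤ 1 := fun a b c => by rcases h01 a b c with h | h <;> simp [h]
  have hn : (0 : ℝ) < Fintype.card V := by exact_mod_cast hV
  set n : ℝ := (Fintype.card V : ℝ) with hn'
  have hlog := sum_log_linkSquare_ge h01 hT hT0 (k := fun _ _ _ => 1) (fun _ _ _ _ => one_pos)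
  have hk₁ : ∀ a b c, f a b c ≠ 0 → 0 < linkSquare f (fun _ _ _ => 1) a c b := fun a b c h =>
    linkSquare_pos hf (fun _ _ _ _ => one_pos) (by rwa [h₂] at h)
  have hlog' := sum_log_linkSquare_ge h01 hT hT0
    (k := fun a b c => linkSquare f (fun _ _ _ => 1) a c b) hk₁
  -- The inner four-cycle lies in the link of `b` instead of `c`; the symmetry of `f` makes the
  -- logarithmic average the same.
  have hperm : ∑ a, ∑ b, ∑ c, f a b c * Real.log (linkSquare f (fun _ _ _ => 1) a c b)
      = ∑ a, ∑ b, ∑ c, f a b c * Real.log (linkSquare f (fun _ _ _ => 1) a b c) := by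
    refine Finset.sum_congr rfl fun a _ => ?_
    rw [Finset.sum_comm]
    exact Finset.sum_congr rfl fun b _ => Finset.sum_congr rfl fun c _ => by rw [h₂]
  rw [hperm] at hlog'
  -- The starting value `T ^ 6 / n ^ 14` is `(T ^ 3 / n ^ 7) ^ 2`, one factor for each nested
  -- four-cycle.
  have h1 := sum_squareStep_pow_mulVec_ge h01 h₂ hT hT0 hV
    (k := linkSquare f fun a b c => linkSquare f (fun _ _ _ => 1) a c b)
    (fun a b c h => linkSquare_pos hf hk₁ h)
    (x := T ^ 6 / n ^ 14) (by positivity) (by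
      rw [Real.log_div (by positivity) (by positivity), Real.log_pow, Real.log_pow]
      simp only [Real.log_one, mul_zero, Finset.sum_const_zero, zero_add] at hlog
      push_cast
      linarith) j
  rw [← hn', ← halfBlock_mulVec_one, Matrix.mulVec_mulVec] at h1
  simp only [Matrix.mulVec, dotProduct, mul_one] at h1
  have h2 := Matrix.sq_sum_le_card_mul_trace_mul_transpose (squareStep f ^ j * halfBlock f)
  rw [Matrix.transpose_mul, Matrix.transpose_pow, squareStep_transpose, Fintype.card_prod,
    Fintype.card_prod, Fintype.card_prod, Nat.cast_mul, Nat.cast_mul, Nat.cast_mul, ← hn'] at h2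
  have h3 : (squareStep f ^ j * halfBlock f * ((halfBlock f)ᵀ * squareStep f ^ j)).trace ≤
      (tightStep f ^ (2 * j + 3)).trace := by
    have hp := Matrix.pow_le_pow_entries (squareStep_nonneg hf) (squareStep_le_tightStep hf hf1) j
    have hb := Matrix.mul_le_mul_entries (halfBlock_nonneg hf)
      (fun i k => halfBlock_nonneg hf k i) (fun _ _ => le_rfl) (fun _ _ => le_rfl)
      (B := (halfBlock f)ᵀ)
    have hb' := Matrix.mul_le_mul_entries (fun i k => (hb i k).1) (fun i k => (hp i k).1)
      (halfBlock_mul_transpose_le hf hf1 h₂) (fun i k => (hp i k).2)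
    have hb'' := Matrix.mul_le_mul_entries (fun i k => (hp i k).1) (fun i k => (hb' i k).1)
      (fun i k => (hp i k).2) (fun i k => (hb' i k).2)
    have e1 : squareStep f ^ j * halfBlock f * ((halfBlock f)ᵀ * squareStep f ^ j)
        = squareStep f ^ j * (halfBlock f * (halfBlock f)ᵀ * squareStep f ^ j) := by
      simp only [Matrix.mul_assoc]
    have e2 : tightStep f ^ (2 * j + 3) = tightStep f ^ j * (tightStep f ^ 3 * tightStep f ^ j) := by
      rw [← pow_add, ← pow_add]
      congr 1
      ring
    rw [e1, e2]
    exact Finset.sum_le_sum fun i _ => (hb'' i i).2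
  refine le_trans ?_ h3
  rw [← mul_le_mul_iff_right₀ (show 0 < n * n * (n * (n * n)) by positivity)]
  refine le_trans ?_ h2
  refine le_trans (le_of_eq ?_) (pow_le_pow_left₀ (by positivity) h1 2)
  obtain ⟨p, hp⟩ : ∃ p, T = p * n ^ 3 := ⟨T / n ^ 3, by field_simp⟩
  have e1 : T / n ^ 3 = p := by rw [hp]; field_simp
  have e2 : T ^ 6 / n ^ 14 = p ^ 6 * n ^ 4 := by rw [hp]; field_simp
  have e3 : T ^ 4 / n ^ 9 = p ^ 4 * n ^ 3 := by rw [hp]; field_simp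
  rw [e1, e2, e3, hp]
  ring

theorem trace_tightStep_pow_ge [DecidableEq V] (h01 : ∀ a b c, f a b c = 0 ∨ f a b c = 1)
    (h₂ : ∀ a b c, f a b c = f a c b) {T : ℝ} (hT : ∑ a, ∑ b, ∑ c, f a b c = T) (hT0 : 0 < T)
    (hT1 : T / (Fintype.card V : ℝ) ^ 3 ≤ 1) (hV : 0 < Fintype.card V) {ℓ : ℕ} (hℓ : 2 ≤ ℓ) :
    (T / (Fintype.card V : ℝ) ^ 3) ^ (4 * ℓ + 2) * (Fintype.card V : ℝ) ^ (3 * ℓ) ≤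
      (tightStep f ^ ℓ).trace := by
  rcases Nat.even_or_odd' ℓ with ⟨m, rfl | rfl⟩
  · obtain ⟨j, rfl⟩ : ∃ j, m = j + 1 := ⟨m - 1, by omega⟩
    refine le_trans ?_ (trace_tightStep_pow_even_ge h01 h₂ hT hT0 hV j)
    rw [show 3 * (2 * (j + 1)) = 6 * (j + 1) by ring]
    refine mul_le_mul_of_nonneg_right ?_ (by positivity)
    -- Even `ℓ` gives the exponent `4ℓ`, weakened here to match the odd case.
    exact pow_le_pow_of_le_one (by positivity) hT1 (by omega)
  · obtain ⟨j, rfl⟩ : ∃ j, m = j + 1 := ⟨m - 1, by omega⟩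
    refine le_trans (le_of_eq ?_) (trace_tightStep_pow_odd_ge h01 h₂ hT hT0 hV j)
    congr 2 <;> ring

end Matrices

/-! ### Traces as counts of closed tight walks -/

section ClosedWalks

theorem Matrix.pow_succ_apply_eq_sum_walks {S : Type*} [Fintype S] [DecidableEq S]
    (M : Matrix S S ℝ) (n : ℕ) (s t : S) :
    (M ^ (n + 1)) s t = ∑ x : Fin (n + 1) → S,
      if x 0 = s then (∏ i : Fin n, M (x i.castSucc) (x i.succ)) * M (x (Fin.last n)) t
      else 0 := by
  induction n generalizing s with
  | zero =>
    rw [← (Equiv.funUnique (Fin 1) S).symm.sum_comp]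
    simp
  | succ n ih =>
    rw [pow_succ', Matrix.mul_apply, ← (Fin.consEquiv fun _ => S).sum_comp,
      Fintype.sum_prod_type]
    simp only [ih, Fin.consEquiv_apply, Fin.cons_zero]
    simp only [Finset.mul_sum]
    rw [Finset.sum_comm]
    conv_rhs => rw [Finset.sum_comm]
    refine Finset.sum_congr rfl fun x _ => ?_
    rw [Finset.sum_ite_eq', if_pos (Finset.mem_univ _),
      Finset.sum_eq_single (x 0) (fun u _ hu => by rw [if_neg hu.symm, mul_zero]) (by simp),
      if_pos rfl, Fin.prod_univ_succ]
    simp only [Fin.castSucc_zero, Fin.cons_zero, Fin.cons_succ, ← Fin.succ_last,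
      ← Fin.succ_castSucc]
    ring

theorem Matrix.trace_pow_succ_eq_sum_closed_walks {S : Type*} [Fintype S] [DecidableEq S]
    (M : Matrix S S ℝ) (n : ℕ) :
    (M ^ (n + 1)).trace = ∑ x : Fin (n + 1) → S, ∏ i, M (x i) (x (i + 1)) := by
  simp only [Matrix.trace, Matrix.diag, Matrix.pow_succ_apply_eq_sum_walks]
  rw [Finset.sum_comm]
  refine Finset.sum_congr rfl fun x _ => ?_
  rw [Finset.sum_ite_eq, if_pos (Finset.mem_univ _), Fin.prod_univ_castSucc]
  simp

variable {V : Type*} [Fintype V] [DecidableEq V] {f : V → V → V → ℝ}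

/-- The transfer matrix of tight walks. -/
def tightTransfer (f : V → V → V → ℝ) : Matrix (V × V) (V × V) ℝ :=
  fun s t => if s.2 = t.1 then f s.1 s.2 t.2 else 0

/-- The three moves are `(a, b) → (b, c) → (c, a') → (a', b')`; the intermediate vertex `c` is
summed out. -/
theorem tightTransfer_pow_three (h₁ : ∀ a b c, f a b c = f b a c)
    (h₂ : ∀ a b c, f a b c = f a c b) : tightTransfer f ^ 3 = tightStep f := by
  ext ⟨a, b⟩ ⟨a', b'⟩
  rw [pow_succ', pow_succ', pow_one]
  simp only [Matrix.mul_apply, tightTransfer, tightStep, Fintype.sum_prod_type, ite_mul, mul_ite,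
    zero_mul, mul_zero, Finset.sum_ite_eq, Finset.sum_ite_eq', Finset.mem_univ, if_true,
    Finset.sum_const_zero, Finset.sum_ite_irrel]
  refine Finset.sum_congr rfl fun c _ => ?_
  rw [h₁ a' b c, h₂ b a' c, h₂ a' b' c, h₁ a' c b', mul_assoc]

theorem trace_tightStep_pow_le_card (h01 : ∀ a b c, f a b c = 0 ∨ f a b c = 1)
    (h₁ : ∀ a b c, f a b c = f b a c) (h₂ : ∀ a b c, f a b c = f a c b) {ℓ : ℕ} (hℓ : 0 < ℓ) :
    (tightStep f ^ ℓ).trace ≤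
      Nat.card {y : ZMod (3 * ℓ) → V // ∀ i, f (y i) (y (i + 1)) (y (i + 2)) = 1} := by
  classical
  obtain ⟨n, hn⟩ : ∃ n, 3 * ℓ = n + 1 := ⟨3 * ℓ - 1, by omega⟩
  rw [← tightTransfer_pow_three h₁ h₂, ← pow_mul, hn,
    Matrix.trace_pow_succ_eq_sum_closed_walks]
  have hM : ∀ s t, tightTransfer f s t = 0 ∨ tightTransfer f s t = 1 := by
    intro s t
    unfold tightTransfer
    split_ifs
    · exact h01 _ _ _
    · exact Or.inl rfl
  let X := {x : Fin (n + 1) → V × V // ∀ i, tightTransfer f (x i) (x (i + 1)) = 1}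
  have hsum : ∑ x : Fin (n + 1) → V × V, ∏ i, tightTransfer f (x i) (x (i + 1))
      = Nat.card X := by
    rw [Nat.card_eq_fintype_card, Fintype.card_subtype, Finset.card_filter]
    push_cast
    refine Finset.sum_congr rfl fun x _ => ?_
    split_ifs with h
    · exact Finset.prod_eq_one fun i _ => h i
    · push Not at h
      obtain ⟨i, hi⟩ := h
      exact Finset.prod_eq_zero (Finset.mem_univ i) ((hM _ _).resolve_right hi)
  rw [hsum, Nat.cast_le]
  have hX : ∀ (x : X) i, (x.1 i).2 = (x.1 (i + 1)).1 ∧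
      f (x.1 i).1 (x.1 i).2 (x.1 (i + 1)).2 = 1 := by
    intro x i
    have h := x.2 i
    unfold tightTransfer at h
    split_ifs at h with h'
    · exact ⟨h', h⟩
    · norm_num at h
  -- A closed walk on pairs is determined by its first coordinates, since each second coordinate is
  -- the next first one. `ZMod (n + 1)` unfolds to `Fin (n + 1)`.
  refine Nat.card_le_card_of_injective
    (β := {y : Fin (n + 1) → V // ∀ i, f (y i) (y (i + 1)) (y (i + 2)) = 1})
    (fun x => ⟨fun i => (x.1 i).1, fun i => ?_⟩) ?_
  · change f (x.1 i).1 (x.1 (i + 1)).1 (x.1 (i + 2)).1 = 1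
    rw [← (hX x i).1, show i + 2 = i + 1 + 1 by
        rw [add_assoc]; congr 1; exact (one_add_one_eq_two (R := ZMod (n + 1))).symm,
      ← (hX x (i + 1)).1]
    exact (hX x i).2
  · intro x x' h
    have h' : ∀ i, (x.1 i).1 = (x'.1 i).1 := fun i => congrFun (congrArg Subtype.val h) i
    ext i
    · exact h' i
    · rw [(hX x i).1, (hX x' i).1, h']

end ClosedWalks

/-! ### From hypergraphs to indicator functions -/

namespace Hypergraph

variable {β : Type*} (H : Hypergraph β)

open Classical in
/-- The indicator function of the ordered triples of vertices that form an edge. -/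
noncomputable def edgeIndicator (a b c : H.vertexSet) : ℝ :=
  if ({(a : β), (b : β), (c : β)} : Set β) ∈ H.edgeSet then 1 else 0

theorem edgeIndicator_eq_zero_or_one (a b c : H.vertexSet) :
    H.edgeIndicator a b c = 0 ∨ H.edgeIndicator a b c = 1 := by
  unfold edgeIndicator
  split_ifs <;> simp

theorem edgeIndicator_eq_one_iff (a b c : H.vertexSet) :
    H.edgeIndicator a b c = 1 ↔ ({(a : β), (b : β), (c : β)} : Set β) ∈ H.edgeSet := by
  unfold edgeIndicator
  split_ifs with h <;> simp [h]

theorem edgeIndicator_swap_left (a b c : H.vertexSet) :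
    H.edgeIndicator a b c = H.edgeIndicator b a c := by
  unfold edgeIndicator
  rw [Set.insert_comm]

theorem edgeIndicator_swap_right (a b c : H.vertexSet) :
    H.edgeIndicator a b c = H.edgeIndicator a c b := by
  unfold edgeIndicator
  rw [Set.pair_comm (b : β)]

theorem mem_edgeSet_completeUniform_self {r : ℕ} {e : Set (Fin r)} :
    e ∈ (completeUniform r r).edgeSet ↔ e = Set.univ := by
  change e.encard = r ↔ _
  constructor
  · intro h
    refine Set.Finite.eq_of_subset_of_encard_le (Set.toFinite _) (Set.subset_univ _) ?_
    simp [h, Set.encard_univ]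
  · rintro rfl
    simp [Set.encard_univ]

/-- Homomorphisms from a single edge are ordered edges. -/
def homCompleteUniformEquiv : Hom (completeUniform 3 3) H ≃
    {x : H.vertexSet × H.vertexSet × H.vertexSet //
      ({(x.1 : β), (x.2.1 : β), (x.2.2 : β)} : Set β) ∈ H.edgeSet} where
  toFun φ := ⟨(φ.1 ⟨0, trivial⟩, φ.1 ⟨1, trivial⟩, φ.1 ⟨2, trivial⟩), by
    have h := φ.2 Set.univ (mem_edgeSet_completeUniform_self.2 rfl)
    convert h using 1
    ext y
    constructor
    · rintro (rfl | rfl | rfl)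
      exacts [⟨⟨0, trivial⟩, trivial, rfl⟩, ⟨⟨1, trivial⟩, trivial, rfl⟩,
        ⟨⟨2, trivial⟩, trivial, rfl⟩]
    · rintro ⟨⟨i, hi⟩, -, rfl⟩
      fin_cases i
      exacts [Or.inl rfl, Or.inr (Or.inl rfl), Or.inr (Or.inr rfl)]⟩
  invFun x := ⟨fun i => ![x.1.1, x.1.2.1, x.1.2.2] i.1, by
    intro e he
    rw [mem_edgeSet_completeUniform_self] at he
    subst he
    convert x.2 using 1
    ext y
    constructor
    · rintro ⟨⟨i, hi⟩, -, rfl⟩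
      fin_cases i
      exacts [Or.inl rfl, Or.inr (Or.inl rfl), Or.inr (Or.inr rfl)]
    · rintro (rfl | rfl | rfl)
      exacts [⟨⟨0, trivial⟩, trivial, rfl⟩, ⟨⟨1, trivial⟩, trivial, rfl⟩,
        ⟨⟨2, trivial⟩, trivial, rfl⟩]⟩
  left_inv φ := by
    apply Subtype.ext
    funext ⟨i, hi⟩
    fin_cases i <;> rfl
  right_inv x := rfl

theorem card_hom_completeUniform [Fintype H.vertexSet] :
    (Nat.card (Hom (completeUniform 3 3) H) : ℝ) = ∑ a, ∑ b, ∑ c, H.edgeIndicator a b c := by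
  classical
  rw [Nat.card_congr H.homCompleteUniformEquiv, Nat.card_eq_fintype_card, Fintype.card_subtype,
    Finset.card_filter]
  push_cast
  simp only [Fintype.sum_prod_type]
  rfl

theorem card_cyclic_le_card_hom_tightCycle [Finite H.vertexSet] {k : ℕ} (hk : 0 < k) :
    Nat.card {y : ZMod k → H.vertexSet // ∀ i, H.edgeIndicator (y i) (y (i + 1)) (y (i + 2)) = 1} ≤
      Nat.card (Hom (tightCycle 3 k) H) := by
  have : NeZero k := ⟨hk.ne'⟩
  have : Finite (tightCycle 3 k).vertexSet := inferInstanceAs (Finite (Set.univ : Set (ZMod k)))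
  have : Finite (Hom (tightCycle 3 k) H) := Subtype.finite
  refine Nat.card_le_card_of_injective
    (fun y => (⟨fun i => y.1 i.1, ?_⟩ : Hom (tightCycle 3 k) H)) ?_
  · rintro e ⟨i, rfl⟩
    have h := (H.edgeIndicator_eq_one_iff _ _ _).1 (y.2 i)
    convert h using 1
    ext z
    constructor
    · rintro ⟨⟨x, hx⟩, ⟨j, hj, rfl⟩, rfl⟩
      interval_cases j
      · left; simp
      · right; left; simp
      · right; right; simp
    · rintro (rfl | rfl | rfl)
      · exact ⟨⟨i, trivial⟩, ⟨0, by norm_num, by simp⟩, rfl⟩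
      · exact ⟨⟨i + 1, trivial⟩, ⟨1, by norm_num, by simp⟩, rfl⟩
      · exact ⟨⟨i + 2, trivial⟩, ⟨2, by norm_num, by simp⟩, rfl⟩
  · intro y y' h
    apply Subtype.ext
    funext i
    exact congrFun (congrArg Subtype.val h) ⟨i, trivial⟩

variable {H}

theorem homDensity_completeUniform_lt_one (hfin : H.vertexSet.Finite) (hH : H.IsUniform 3) :
    homDensity (completeUniform 3 3) H < 1 := by
  have := hfin.fintype
  have hcard : H.vertexSet.ncard = Fintype.card H.vertexSet := by
    rw [← Nat.card_coe_set_eq, Nat.card_eq_fintype_card]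
  have h3 : (completeUniform 3 3).vertexSet.ncard = 3 := by
    change (Set.univ : Set (Fin 3)).ncard = 3
    simp [Set.ncard_univ]
  rw [homDensity, hcard, h3, card_hom_completeUniform]
  rcases isEmpty_or_nonempty H.vertexSet with he | ⟨⟨v⟩⟩
  · simp
  have hn : (0 : ℝ) < Fintype.card H.vertexSet := by
    have : Nonempty H.vertexSet := ⟨v⟩
    exact_mod_cast Fintype.card_pos
  rw [div_lt_one (by positivity)]
  have hlt : ∑ x : H.vertexSet × H.vertexSet × H.vertexSet, H.edgeIndicator x.1 x.2.1 x.2.2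
      < ∑ _x : H.vertexSet × H.vertexSet × H.vertexSet, (1 : ℝ) := by
    -- Strictness comes from the constant triple `(v, v, v)`, which spans one vertex and so is not
    -- an edge.
    refine Finset.sum_lt_sum (fun x _ => ?_) ⟨(v, v, v), Finset.mem_univ _, ?_⟩
    · rcases H.edgeIndicator_eq_zero_or_one x.1 x.2.1 x.2.2 with h | h <;> simp [h]
    · have : H.edgeIndicator v v v ≠ 1 := by
        rw [Ne, edgeIndicator_eq_one_iff]
        intro h
        have := hH _ h
        simp at this
      rw [(H.edgeIndicator_eq_zero_or_one v v v).resolve_right this]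
      exact one_pos
  simp only [Fintype.sum_prod_type, Finset.sum_const, Finset.card_univ, nsmul_eq_mul,
    mul_one, Fintype.card_prod, Nat.cast_mul] at hlt
  calc _ < _ := hlt
    _ = _ := by ring

theorem homDensity_tightCycle_ge (hfin : H.vertexSet.Finite)
    (hp : 0 < homDensity (completeUniform 3 3) H) (hp1 : homDensity (completeUniform 3 3) H ≤ 1)
    {ℓ : ℕ} (hℓ : 2 ≤ ℓ) :
    homDensity (completeUniform 3 3) H ^ (4 * ℓ + 2) ≤ homDensity (tightCycle 3 (3 * ℓ)) H := by
  classical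
  have := hfin.fintype
  have hcard : H.vertexSet.ncard = Fintype.card H.vertexSet := by
    rw [← Nat.card_coe_set_eq, Nat.card_eq_fintype_card]
  have h3 : (completeUniform 3 3).vertexSet.ncard = 3 := by
    change (Set.univ : Set (Fin 3)).ncard = 3
    simp [Set.ncard_univ]
  have h3ℓ : (tightCycle 3 (3 * ℓ)).vertexSet.ncard = 3 * ℓ := by
    change (Set.univ : Set (ZMod (3 * ℓ))).ncard = 3 * ℓ
    simp [Set.ncard_univ]
  have hdef : homDensity (completeUniform 3 3) H
      = (∑ a, ∑ b, ∑ c, H.edgeIndicator a b c) / (Fintype.card H.vertexSet : ℝ) ^ 3 := by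
    rw [homDensity, hcard, h3, card_hom_completeUniform]
  have hV : 0 < Fintype.card H.vertexSet := by
    rcases Nat.eq_zero_or_pos (Fintype.card H.vertexSet) with h | h
    · rw [hdef, h] at hp
      simp at hp
    · exact h
  have hn : (0 : ℝ) < Fintype.card H.vertexSet := by exact_mod_cast hV
  rw [hdef] at hp hp1 ⊢
  have hT0 : 0 < ∑ a, ∑ b, ∑ c, H.edgeIndicator a b c := by
    rwa [div_pos_iff_of_pos_right (by positivity)] at hp
  have h := trace_tightStep_pow_ge H.edgeIndicator_eq_zero_or_one H.edgeIndicator_swap_right rfl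
    hT0 hp1 hV hℓ
  have h' := trace_tightStep_pow_le_card H.edgeIndicator_eq_zero_or_one H.edgeIndicator_swap_left
    H.edgeIndicator_swap_right (show 0 < ℓ by omega)
  have h'' : (_ : ℝ) ≤ _ :=
    Nat.cast_le.2 (H.card_cyclic_le_card_hom_tightCycle (k := 3 * ℓ) (by omega))
  rw [homDensity, hcard, h3ℓ, le_div_iff₀ (by positivity)]
  exact h.trans (h'.trans h'')

end Hypergraph

/-! ### The bound on the exponent -/

theorem theorem2p2 (ℓ : ℕ) (hℓ : 2 ≤ ℓ) :
    Hypergraph.sidorenkoExponent 3 (Hypergraph.tightCycle 3 (3 * ℓ)) ≤ 7 * (ℓ : ℝ≥0∞) := by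
  refine iSup₂_le fun s hs => ?_
  obtain ⟨V, H, hfin, hunif, heq, hpos⟩ := hs
  have hp1 := Hypergraph.homDensity_completeUniform_lt_one hfin hunif
  have hp0 : 0 ≤ Hypergraph.homDensity (Hypergraph.completeUniform 3 3) H := by
    unfold Hypergraph.homDensity
    positivity
  have hreal : (s : ℝ) ≤ 7 * ℓ := by
    -- The exponent 0 is separate: since `0 ^ 0 = 1`, it does not force the edge density to be
    -- positive.
    rcases eq_or_ne s 0 with rfl | hs0
    · simp
    have hp : 0 < Hypergraph.homDensity (Hypergraph.completeUniform 3 3) H := by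
      refine lt_of_le_of_ne hp0 fun h => ?_
      rw [← h, Real.zero_rpow (by exact_mod_cast hs0)] at hpos
      exact lt_irrefl _ hpos
    have h := Hypergraph.homDensity_tightCycle_ge hfin hp hp1.le hℓ
    -- As the base is below 1, comparing powers reverses to `s ≤ 4ℓ + 2`.
    rw [heq, ← Real.rpow_natCast, Real.rpow_le_rpow_left_iff_of_base_lt_one hp hp1] at h
    have hℓ' : (2 : ℝ) ≤ ℓ := by exact_mod_cast hℓ
    push_cast at h
    linarith
  have : s ≤ 7 * (ℓ : ℝ≥0) := by exact_mod_cast hreal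
  exact_mod_cast this
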